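/- Let $\Bbbk$ be an arbitrary field and let $X$ be a set. An \emph{SLS-algebra} over $\Bbbk$ is a vector space $A$ over $\Bbbk$ with a bilinear product $\circ$ satisfying, for all $x,y,z,u\in A$, $$(x,y,z)=(y,x,z),\qquad ((x\circ y)\circ z)\circ u=((x\circ z)\circ y)\circ u,\qquad (x,y\circ z,u)=(y,x\circ z,u),$$ where $(a,b,c)=(a\circ b)\circ c-a\circ(b\circ c)$. Let $A\circ A$ denote the linear span of all products $a\circ b$ with $a,b\in A$. An SLS-algebra $A$ is called \emph{nice} if for every $x\in A$ there exists a linear map $\mu_x\colon A\circ A\to A$ such that $\mu_x(a\circ b)=(a\circ x)\circ b$ for all $a,b\in A$. Corollary. The free SLS-algebra $\mathrm{SLS}\langle X\rangle$ generated by $X$ is a nice SLS-algebra. -/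

import Mathlib

/-- A left-symmetric (left pre-Lie) algebra is an *SLS-algebra* if it satisfies
`((x ∘ y) ∘ z) ∘ u = ((x ∘ z) ∘ y) ∘ u` and `(x, y ∘ z, u) = (y, x ∘ z, u)`, where
`(a, b, c) = (a ∘ b) ∘ c - a ∘ (b ∘ c)` is the associator. The product `∘` is written `*`;
left symmetry `(a, b, c) = (b, a, c)` is carried by `LeftPreLieRing`. -/
structure IsSLSAlgebra (A : Type*) [LeftPreLieRing A] : Prop where
  right_comm_mul : ∀ x y z u : A, ((x * y) * z) * u = ((x * z) * y) * u
  associator_mul : ∀ x y z u : A, associator x (y * z) u = associator y (x * z) u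

/-- The subspace `A ∘ A` of `A`: the linear span of all products `a ∘ b`. -/
def mulSpan (k A : Type*) [Field k] [LeftPreLieRing A] [LeftPreLieAlgebra k A] :
    Submodule k A :=
  Submodule.span k {c : A | ∃ a b : A, a * b = c}

theorem mul_mem_mulSpan (k : Type*) {A : Type*} [Field k] [LeftPreLieRing A]
    [LeftPreLieAlgebra k A] (a b : A) : a * b ∈ mulSpan k A :=
  Submodule.subset_span ⟨a, b, rfl⟩

/-- A *nice SLS-algebra* over the field `k`: an SLS-algebra `A` such that for every `x ∈ A`
there is a linear map `μₓ : A ∘ A → A` with `μₓ (a ∘ b) = (a ∘ x) ∘ b` for all `a, b ∈ A`. -/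
structure IsNiceSLSAlgebra (k A : Type*) [Field k] [LeftPreLieRing A]
    [LeftPreLieAlgebra k A] : Prop where
  isSLS : IsSLSAlgebra A
  exists_linearMap : ∀ x : A, ∃ μ : mulSpan k A →ₗ[k] A,
    ∀ a b : A, μ ⟨a * b, mul_mem_mulSpan k a b⟩ = (a * x) * b

namespace FreeSLSAlgebra

/-- The relation on the free non-associative algebra on `X` that imposes left symmetry and the
two identities of SLS-algebras, compatibly with the algebra operations. -/
inductive Rel (k X : Type*) [Field k] :
    FreeNonUnitalNonAssocAlgebra k X → FreeNonUnitalNonAssocAlgebra k X → Prop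
  | left_symm (x y z : FreeNonUnitalNonAssocAlgebra k X) :
      Rel k X (associator x y z) (associator y x z)
  | right_comm_mul (x y z u : FreeNonUnitalNonAssocAlgebra k X) :
      Rel k X (((x * y) * z) * u) (((x * z) * y) * u)
  | associator_mul (x y z u : FreeNonUnitalNonAssocAlgebra k X) :
      Rel k X (associator x (y * z) u) (associator y (x * z) u)
  | smul (t : k) {a b : FreeNonUnitalNonAssocAlgebra k X} :
      Rel k X a b → Rel k X (t • a) (t • b)
  | add_right {a b : FreeNonUnitalNonAssocAlgebra k X} (c : FreeNonUnitalNonAssocAlgebra k X) :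
      Rel k X a b → Rel k X (a + c) (b + c)
  | mul_left (a : FreeNonUnitalNonAssocAlgebra k X) {b c : FreeNonUnitalNonAssocAlgebra k X} :
      Rel k X b c → Rel k X (a * b) (a * c)
  | mul_right {a b : FreeNonUnitalNonAssocAlgebra k X} (c : FreeNonUnitalNonAssocAlgebra k X) :
      Rel k X a b → Rel k X (a * c) (b * c)

theorem Rel.add_left {k X : Type*} [Field k] (a : FreeNonUnitalNonAssocAlgebra k X)
    {b c : FreeNonUnitalNonAssocAlgebra k X} (h : Rel k X b c) : Rel k X (a + b) (a + c) := by
  rw [add_comm a b, add_comm a c]; exact h.add_right _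

theorem Rel.neg {k X : Type*} [Field k] {a b : FreeNonUnitalNonAssocAlgebra k X}
    (h : Rel k X a b) : Rel k X (-a) (-b) := by
  simpa only [neg_one_smul] using h.smul (-1)

theorem Rel.sub_left {k X : Type*} [Field k] (a : FreeNonUnitalNonAssocAlgebra k X)
    {b c : FreeNonUnitalNonAssocAlgebra k X} (h : Rel k X b c) : Rel k X (a - b) (a - c) := by
  simpa only [sub_eq_add_neg] using h.neg.add_left a

theorem Rel.sub_right {k X : Type*} [Field k] {a b : FreeNonUnitalNonAssocAlgebra k X}
    (c : FreeNonUnitalNonAssocAlgebra k X) (h : Rel k X a b) : Rel k X (a - c) (b - c) := by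
  simpa only [sub_eq_add_neg] using h.add_right (-c)

end FreeSLSAlgebra

/-- The free SLS-algebra `SLS⟨X⟩` over the field `k` generated by the set `X`: the quotient of
the free non-associative algebra on `X` by the identities defining SLS-algebras. -/
def FreeSLSAlgebra (k X : Type*) [Field k] : Type _ :=
  Quot (FreeSLSAlgebra.Rel k X)

namespace FreeSLSAlgebra

noncomputable section

instance (k X : Type*) [Field k] : SMul ℕ (FreeSLSAlgebra k X) where
  smul n := Quot.map (n • ·) (fun a b h => by
    simpa only [Nat.cast_smul_eq_nsmul] using h.smul (n : k))

instance (k X : Type*) [Field k] : SMul ℤ (FreeSLSAlgebra k X) where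
  smul n := Quot.map (n • ·) (fun a b h => by
    simpa only [Int.cast_smul_eq_zsmul] using h.smul (n : k))

instance (k X : Type*) [Field k] : SMul k (FreeSLSAlgebra k X) where
  smul t := Quot.map (t • ·) (fun _ _ h => h.smul t)

instance (k X : Type*) [Field k] : Zero (FreeSLSAlgebra k X) where
  zero := Quot.mk _ 0

instance (k X : Type*) [Field k] : Add (FreeSLSAlgebra k X) where
  add := Quot.map₂ (· + ·) (fun _ _ _ => Rel.add_left _) fun _ _ _ => Rel.add_right _

instance (k X : Type*) [Field k] : Neg (FreeSLSAlgebra k X) where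
  neg := Quot.map Neg.neg fun _ _ => Rel.neg

instance (k X : Type*) [Field k] : Sub (FreeSLSAlgebra k X) where
  sub := Quot.map₂ Sub.sub (fun _ _ _ => Rel.sub_left _) fun _ _ _ => Rel.sub_right _

instance (k X : Type*) [Field k] : Mul (FreeSLSAlgebra k X) where
  mul := Quot.map₂ (· * ·) (fun _ _ _ => Rel.mul_left _) fun _ _ _ => Rel.mul_right _

instance (k X : Type*) [Field k] : NonUnitalNonAssocRing (FreeSLSAlgebra k X) :=
  Function.Surjective.nonUnitalNonAssocRing (Quot.mk _) Quot.mk_surjective rfl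
    (fun _ _ => rfl) (fun _ _ => rfl) (fun _ => rfl) (fun _ _ => rfl) (fun _ _ => rfl)
    (fun _ _ => rfl)

instance (k X : Type*) [Field k] : LeftPreLieRing (FreeSLSAlgebra k X) where
  assoc_symm' := by
    rintro ⟨x⟩ ⟨y⟩ ⟨z⟩
    exact Quot.sound (Rel.left_symm x y z)

instance (k X : Type*) [Field k] : Module k (FreeSLSAlgebra k X) :=
  Function.Surjective.module k ⟨⟨Quot.mk (Rel k X), rfl⟩, fun _ _ => rfl⟩
    Quot.mk_surjective (fun _ _ => rfl)

instance (k X : Type*) [Field k] : LeftPreLieAlgebra k (FreeSLSAlgebra k X) where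
  smul_assoc := by
    rintro t ⟨a⟩ ⟨b⟩
    exact congrArg (Quot.mk _) (smul_mul_assoc t a b)
  smul_comm := by
    rintro t ⟨a⟩ ⟨b⟩
    exact congrArg (Quot.mk _) (mul_smul_comm t a b).symm

/-- The canonical map from `X` to the free SLS-algebra. -/
def of (k : Type*) {X : Type*} [Field k] (x : X) : FreeSLSAlgebra k X :=
  Quot.mk _ (FreeNonUnitalNonAssocAlgebra.of k x)

/-- The free SLS-algebra is an SLS-algebra. -/
theorem isSLSAlgebra (k X : Type*) [Field k] : IsSLSAlgebra (FreeSLSAlgebra k X) where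
  right_comm_mul := by
    rintro ⟨x⟩ ⟨y⟩ ⟨z⟩ ⟨u⟩
    exact Quot.sound (Rel.right_comm_mul x y z u)
  associator_mul := by
    rintro ⟨x⟩ ⟨y⟩ ⟨z⟩ ⟨u⟩
    exact Quot.sound (Rel.associator_mul x y z u)

/-- The universal property: every map from `X` to an SLS-algebra `A` extends uniquely to a
homomorphism of algebras from the free SLS-algebra to `A`. -/
theorem existsUnique_lift {k X A : Type*} [Field k] [LeftPreLieRing A] [LeftPreLieAlgebra k A]
    (hA : IsSLSAlgebra A) (f : X → A) :
    ∃! F : FreeSLSAlgebra k X →ₙₐ[k] A, ∀ x, F (of k x) = f x := by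
  have key : ∀ a b, Rel k X a b →
      FreeNonUnitalNonAssocAlgebra.lift k f a = FreeNonUnitalNonAssocAlgebra.lift k f b := by
    intro a b h
    induction h with
    | left_symm x y z =>
      simpa only [associator_apply, map_sub, map_mul] using LeftPreLieRing.assoc_symm
        (FreeNonUnitalNonAssocAlgebra.lift k f x) (FreeNonUnitalNonAssocAlgebra.lift k f y)
        (FreeNonUnitalNonAssocAlgebra.lift k f z)
    | right_comm_mul x y z u =>
      simp only [map_mul]
      exact hA.right_comm_mul _ _ _ _
    | associator_mul x y z u =>
      simpa only [associator_apply, map_sub, map_mul] using hA.associator_mul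
        (FreeNonUnitalNonAssocAlgebra.lift k f x) (FreeNonUnitalNonAssocAlgebra.lift k f y)
        (FreeNonUnitalNonAssocAlgebra.lift k f z) (FreeNonUnitalNonAssocAlgebra.lift k f u)
    | smul t _ ih => simp only [map_smul, ih]
    | add_right c _ ih => simp only [map_add, ih]
    | mul_left a _ ih => simp only [map_mul, ih]
    | mul_right c _ ih => simp only [map_mul, ih]
  let π : FreeNonUnitalNonAssocAlgebra k X →ₙₐ[k] FreeSLSAlgebra k X :=
    { toFun := Quot.mk _
      map_smul' := fun _ _ => rfl
      map_zero' := rfl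
      map_add' := fun _ _ => rfl
      map_mul' := fun _ _ => rfl }
  refine ⟨{ toFun := Quot.lift (FreeNonUnitalNonAssocAlgebra.lift k f) key
            map_smul' := ?_, map_zero' := ?_, map_add' := ?_, map_mul' := ?_ }, ?_, ?_⟩
  · rintro t ⟨a⟩
    exact map_smul (FreeNonUnitalNonAssocAlgebra.lift k f) t a
  · exact map_zero (FreeNonUnitalNonAssocAlgebra.lift k f)
  · rintro ⟨a⟩ ⟨b⟩
    exact map_add (FreeNonUnitalNonAssocAlgebra.lift k f) a b
  · rintro ⟨a⟩ ⟨b⟩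
    exact map_mul (FreeNonUnitalNonAssocAlgebra.lift k f) a b
  · intro x
    exact FreeNonUnitalNonAssocAlgebra.lift_of_apply k f x
  · intro G hG
    have h : G.comp π = FreeNonUnitalNonAssocAlgebra.lift k f := by
      apply FreeNonUnitalNonAssocAlgebra.hom_ext
      intro x
      rw [FreeNonUnitalNonAssocAlgebra.lift_of_apply]
      exact hG x
    ext ⟨a⟩
    exact NonUnitalAlgHom.congr_fun h a

end

end FreeSLSAlgebra

/-! The map `a ∘ b ↦ (a ∘ x) ∘ b` is well defined on `A ∘ A` when it respects every linear relation
among products. For free `A`, a homomorphism provides this. Put on `E = A × A` the product `(a,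
m)(b, n) = (a ∘ b, (a ∘ x) ∘ b)`. If `E` is an SLS-algebra, freeness gives a section `F : A → E` of
the first projection, and the second coordinate of `F` is a linear map sending `a ∘ b` to `(a ∘ x) ∘
b`. That `E` is an SLS-algebra holds for any SLS-algebra `A`: each defining identity must survive
inserting `x` after its outermost left factor, which is the content of `left_symm_insert` and
`associator_mul_insert`. -/

namespace IsSLSAlgebra

variable {A : Type*} [LeftPreLieRing A]

theorem left_symm (x y z : A) : associator x y z = associator y x z :=
  LeftPreLieRing.assoc_symm x y z

/-- Left symmetry remains valid after inserting `t` on the right of each left factor. -/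
theorem left_symm_insert (hA : IsSLSAlgebra A) (x y z t : A) :
    ((x * y) * t) * z - (x * t) * (y * z) = ((y * x) * t) * z - (y * t) * (x * z) := by
  -- By `right_comm_mul` the two sides are `(x ∘ t, y, z)` and `(y ∘ t, x, z)`. They agree through
  -- `(x ∘ t, y, z) = (y, x ∘ t, z) = (x, y ∘ t, z) = (y ∘ t, x, z)`.
  have h₁ := hA.associator_mul x y t z
  have h₂ := left_symm (x * t) y z
  have h₃ := left_symm (y * t) x z
  rw [hA.right_comm_mul x y t z, hA.right_comm_mul y x t z]
  simp only [associator_apply] at h₁ h₂ h₃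
  rw [h₂, h₃, h₁]

/-- The relation `(x, y ∘ z, u) = (y, x ∘ z, u)` remains valid after inserting `t` on the right
of each left factor. -/
theorem associator_mul_insert (hA : IsSLSAlgebra A) (x y z u t : A) :
    ((x * (y * z)) * t) * u - (x * t) * ((y * z) * u) =
      ((y * (x * z)) * t) * u - (y * t) * ((x * z) * u) := by
  -- By `h₇` and `h₉` the claim is `(x ∘ t, y ∘ z, u) = (y ∘ t, x ∘ z, u)`. The left side is `(y, (x
  -- ∘ t) ∘ z, u) = ((x ∘ t) ∘ z, y, u)` by `h₆`, `h₅`; the right side is `(x ∘ z, y ∘ t, u) = (y,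
  -- (x ∘ z) ∘ t, u) = ((x ∘ z) ∘ t, y, u)` by `h₃`, `h₂`, `h₄`. The two results agree term by term
  -- by `h₁` and `h₈`.
  have h₁ := congrArg (· * u) (hA.right_comm_mul x t z y)
  have h₂ := hA.associator_mul (x * z) y t u
  have h₃ := left_symm (y * t) (x * z) u
  have h₄ := left_symm y ((x * z) * t) u
  have h₅ := left_symm y ((x * t) * z) u
  have h₆ := hA.associator_mul y (x * t) z u
  have h₇ := hA.right_comm_mul x t (y * z) u
  have h₈ := hA.right_comm_mul x t z (y * u)
  have h₉ := hA.right_comm_mul y t (x * z) u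
  simp only [associator_apply] at h₁ h₂ h₃ h₄ h₅ h₆ h₇ h₈ h₉
  linear_combination (norm := abel) h₁ - h₂ - h₃ - h₄ + h₅ - h₆ - h₇ - h₈ + h₉

/-- The extension of an SLS-algebra `A` by the vector space `A` (with zero multiplication) along
the bilinear map `(a, b) ↦ (a ∘ x) ∘ b`. -/
@[nolint unusedArguments]
def InsertExtension (_ : IsSLSAlgebra A) (_ : A) : Type _ := A × A

namespace InsertExtension

variable {hA : IsSLSAlgebra A} {x : A}

instance : AddCommGroup (InsertExtension hA x) := inferInstanceAs (AddCommGroup (A × A))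

instance {k : Type*} [Field k] [LeftPreLieAlgebra k A] : Module k (InsertExtension hA x) :=
  inferInstanceAs (Module k (A × A))

/-- Second coordinates of the factors never enter a product, so an identity in `InsertExtension`
amounts to the same identity in `A` together with its version with `x` inserted. -/
instance : Mul (InsertExtension hA x) where
  mul p q := (p.1 * q.1, (p.1 * x) * q.1)

@[ext]
theorem ext {p q : InsertExtension hA x} (h₁ : p.1 = q.1) (h₂ : p.2 = q.2) : p = q :=
  Prod.ext h₁ h₂

@[simp] theorem fst_zero : (0 : InsertExtension hA x).1 = 0 := rfl
@[simp] theorem snd_zero : (0 : InsertExtension hA x).2 = 0 := rfl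
@[simp] theorem fst_add (p q : InsertExtension hA x) : (p + q).1 = p.1 + q.1 := rfl
@[simp] theorem snd_add (p q : InsertExtension hA x) : (p + q).2 = p.2 + q.2 := rfl
@[simp] theorem fst_sub (p q : InsertExtension hA x) : (p - q).1 = p.1 - q.1 := rfl
@[simp] theorem snd_sub (p q : InsertExtension hA x) : (p - q).2 = p.2 - q.2 := rfl
@[simp] theorem fst_mul (p q : InsertExtension hA x) : (p * q).1 = p.1 * q.1 := rfl
@[simp] theorem snd_mul (p q : InsertExtension hA x) : (p * q).2 = (p.1 * x) * q.1 := rfl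

section Module

variable {k : Type*} [Field k] [LeftPreLieAlgebra k A]

@[simp] theorem fst_smul (c : k) (p : InsertExtension hA x) : (c • p).1 = c • p.1 := rfl
@[simp] theorem snd_smul (c : k) (p : InsertExtension hA x) : (c • p).2 = c • p.2 := rfl

end Module

instance : NonUnitalNonAssocRing (InsertExtension hA x) where
  left_distrib p q r := by ext <;> simp [mul_add]
  right_distrib p q r := by ext <;> simp [add_mul]
  zero_mul p := by ext <;> simp
  mul_zero p := by ext <;> simp

instance : LeftPreLieRing (InsertExtension hA x) where
  assoc_symm' p q r := by
    ext
    · simpa only [associator_apply, fst_sub, fst_mul] using left_symm p.1 q.1 r.1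
    · simpa only [associator_apply, snd_sub, snd_mul, fst_mul] using
        hA.left_symm_insert p.1 q.1 r.1 x

instance {k : Type*} [Field k] [LeftPreLieAlgebra k A] :
    LeftPreLieAlgebra k (InsertExtension hA x) where
  smul_assoc c p q := by ext <;> simp [smul_mul_assoc]
  smul_comm c p q := by ext <;> simp [mul_smul_comm]

theorem isSLSAlgebra : IsSLSAlgebra (InsertExtension hA x) where
  right_comm_mul p q r s := by
    ext
    · simpa only [fst_mul] using hA.right_comm_mul p.1 q.1 r.1 s.1
    · simp only [snd_mul, fst_mul]
      -- The inserted `x` plays the role of the last factor in the identity of `A`.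
      rw [hA.right_comm_mul p.1 q.1 r.1 x]
  associator_mul p q r s := by
    ext
    · simpa only [associator_apply, fst_sub, fst_mul] using hA.associator_mul p.1 q.1 r.1 s.1
    · simpa only [associator_apply, snd_sub, snd_mul, fst_mul] using
        hA.associator_mul_insert p.1 q.1 r.1 s.1 x

variable (hA x) in
/-- The projection of the extension onto `A`. -/
def fstHom (k : Type*) [Field k] [LeftPreLieAlgebra k A] : InsertExtension hA x →ₙₐ[k] A where
  toFun p := p.1
  map_smul' _ _ := rfl
  map_zero' := rfl
  map_add' _ _ := rfl
  map_mul' _ _ := rfl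

variable (hA x) in
/-- The second coordinate of the extension, as a linear map. -/
def sndLinearMap (k : Type*) [Field k] [LeftPreLieAlgebra k A] :
    InsertExtension hA x →ₗ[k] A where
  toFun p := p.2
  map_smul' _ _ := rfl
  map_add' _ _ := rfl

end InsertExtension

end IsSLSAlgebra

namespace FreeSLSAlgebra

open IsSLSAlgebra

/-- In the free SLS-algebra `a ∘ b ↦ (a ∘ x) ∘ b` is induced by a linear map. -/
theorem exists_linearMap_mul (k X : Type*) [Field k] (x : FreeSLSAlgebra k X) :
    ∃ μ : FreeSLSAlgebra k X →ₗ[k] FreeSLSAlgebra k X, ∀ a b, μ (a * b) = (a * x) * b := by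
  have hA := isSLSAlgebra k X
  -- The second coordinate `0` is arbitrary: it fixes `μ` on generators, while only the values of
  -- `μ` on products matter.
  obtain ⟨F, hF, -⟩ := existsUnique_lift (k := k) (A := InsertExtension hA x)
    InsertExtension.isSLSAlgebra (fun i : X => (of k i, 0))
  -- Both sides are endomorphisms fixing the generators, so uniqueness of the lift identifies them.
  have hfst : (InsertExtension.fstHom hA x k).comp F = NonUnitalAlgHom.id k _ :=
    (existsUnique_lift hA (of k)).unique (fun i => congrArg Prod.fst (hF i)) fun _ => rfl
  have h (a : FreeSLSAlgebra k X) : (F a).1 = a := NonUnitalAlgHom.congr_fun hfst a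
  refine ⟨InsertExtension.sndLinearMap hA x k ∘ₗ (F : FreeSLSAlgebra k X →ₗ[k] _),
    fun a b => ?_⟩
  change (F (a * b)).2 = _
  rw [map_mul, InsertExtension.snd_mul, h, h]

end FreeSLSAlgebra

theorem mainTheorem10 (k X : Type*) [Field k] :
    IsNiceSLSAlgebra k (FreeSLSAlgebra k X) := by
  refine ⟨FreeSLSAlgebra.isSLSAlgebra k X, fun x => ?_⟩
  obtain ⟨μ, hμ⟩ := FreeSLSAlgebra.exists_linearMap_mul k X x
  exact ⟨μ ∘ₗ (mulSpan k (FreeSLSAlgebra k X)).subtype, fun a b => hμ a b⟩
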